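/- Let $k$ be a positive integer, let $H$ be a finite subgroup of $SO(3)$, and let $G$ be a finite group that fits into a short exact sequence $$1\longrightarrow \mathbb Z_k\longrightarrow G\longrightarrow H\longrightarrow 1$$ in which the image of the cyclic group $\mathbb Z_k$ lies in the center of $G$. Then $G$ is isomorphic to a subgroup of $SO(5)$. -/

import Mathlib

/-- A group extension `1 → N → E → Q → 1` is central if the image of `N` lies in the center
of `E`. -/
def GroupExtension.IsCentralExt {N E Q : Type*} [Group N] [Group E] [Group Q]
    (S : GroupExtension N E Q) : Prop :=
  S.inl.range ≤ Subgroup.center E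

/-!
Pull the double cover of `SO(3)` by the unit quaternions back along `G → H ⊆ SO(3)`: let `E` be
the group of pairs `(g, q)` where the unit quaternion `q` induces the rotation attached to `g`
(`Quaternion.spinPullback`; such a `q` exists by `Quaternion.exists_induces`). It is a central
extension of `H` by `Z × {1, -1}`, with `Z` cyclic of order `k`, and `G` is its quotient by
`{1, -1}`.

Every finite subgroup of `SO(3)` has Schur multiplier of order at most two, generated by the class
of the spin cover. Stated without cohomology or the classification of these subgroups: the
projection `f : E → ℍ` is injective on the commutator subgroup of `E`
(`eq_one_of_mem_commutator_of_map_eq_one`). Transfer to a Sylow subgroup reduces this to a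
`p`-group `P`. An element that is central in `P` modulo the kernel of the action on space gives an
axis preserved by `P`, up to direction. The elements of `P` fixing its direction form an abelian
subgroup, as the centralizer of a non-real quaternion is a copy of `ℂ`; an element `s` reversing
the direction acts on the image of it under `f` by inversion, so that every commutator is some
`⁅s, a⁆` with `f ⁅s, a⁆ = (f a)⁻²`.

Hence at most one nontrivial element of `Z × {1, -1}` is a product of commutators in `E`, and it
has the form `(z, -1)`. So for a faithful character `χ₀` of `Z`, either `χ₀` or `χ₀` times the
sign of `{1, -1}` extends to a character `χ` of `E` (`exists_circle_character`). In the first case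
`(g, q) ↦ (χ (g, q), rotation of g)` is a homomorphism to `SO(2) × SO(3)`. In the second case
`(g, q)` acts on `ℍ` by `x ↦ q x χ(g, q)`, which gives a homomorphism to `O(4)`, and `O(4)` embeds in
`SO(5)` by `A ↦ diag(A, det A)`. In both cases the kernel is that of `E → G`.
-/

open scoped Quaternion commutatorElement

/-! ### Subgroups of the quaternions -/

theorem Quaternion.exists_eq_add_smul_of_commute {q x : ℍ[ℝ]} (hq : q.im ≠ 0)
    (hx : q * x = x * q) : ∃ a b : ℝ, x = a + b • q := by
  have hn : q.imI ^ 2 + q.imJ ^ 2 + q.imK ^ 2 ≠ 0 := by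
    intro h
    apply hq
    ext <;> simp <;> nlinarith [sq_nonneg q.imI, sq_nonneg q.imJ, sq_nonneg q.imK]
  have h1 := congrArg (·.imI) hx
  have h2 := congrArg (·.imJ) hx
  have h3 := congrArg (·.imK) hx
  simp only [Quaternion.imI_mul, Quaternion.imJ_mul, Quaternion.imK_mul] at h1 h2 h3
  obtain ⟨b, hb⟩ : ∃ b : ℝ, b = (x.imI * q.imI + x.imJ * q.imJ + x.imK * q.imK) /
    (q.imI ^ 2 + q.imJ ^ 2 + q.imK ^ 2) := ⟨_, rfl⟩
  refine ⟨x.re - b * q.re, b, ?_⟩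
  ext
  · simp
  all_goals
    simp
    rw [hb]
    field_simp
  · linear_combination q.imK / 2 * h2 - q.imJ / 2 * h3
  · linear_combination q.imI / 2 * h3 - q.imK / 2 * h1
  · linear_combination q.imJ / 2 * h1 - q.imI / 2 * h2

/-- The centralizer of a non-real quaternion is contained in a copy of `ℂ`. -/
theorem Quaternion.exists_algHom_complex_of_im_ne_zero {q : ℍ[ℝ]} (hq : q.im ≠ 0) :
    ∃ φ : ℂ →ₐ[ℝ] ℍ[ℝ], ∀ x, q * x = x * q → ∃ z, φ z = x := by
  have hn : 0 < q.imI ^ 2 + q.imJ ^ 2 + q.imK ^ 2 := by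
    by_contra h
    apply hq
    ext <;> simp <;> nlinarith [sq_nonneg q.imI, sq_nonneg q.imJ, sq_nonneg q.imK]
  obtain ⟨r, hr, hrn⟩ : ∃ r : ℝ, 0 < r ∧ r ^ 2 = q.imI ^ 2 + q.imJ ^ 2 + q.imK ^ 2 :=
    ⟨_, Real.sqrt_pos.2 hn, Real.sq_sqrt hn.le⟩
  have hr0 := hr.ne'
  have hI : (r⁻¹ • q.im) * (r⁻¹ • q.im) = -1 := by
    have : q.im * q.im = -((r ^ 2 : ℝ) : ℍ[ℝ]) := by
      ext <;> simp [-Quaternion.coe_pow] <;> linarith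
    rw [smul_mul_smul_comm, this, ← Quaternion.coe_neg, Quaternion.smul_coe]
    field_simp
    simp
  refine ⟨Complex.lift ⟨_, hI⟩, fun x hx => ?_⟩
  obtain ⟨a, b, rfl⟩ := Quaternion.exists_eq_add_smul_of_commute hq hx
  refine ⟨⟨a + b * q.re, b * r⟩, ?_⟩
  ext <;> simp [Complex.lift, Complex.liftAux_apply] <;> field_simp

/-- Conjugation by a quaternion that anticommutes with the non-real `q` restricts to the
quaternion conjugation on the centralizer of `q`. -/
theorem Quaternion.mul_eq_star_mul_of_anticommute {q s x : ℍ[ℝ]} (hq : q.im ≠ 0)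
    (hs : q * s = -(s * q)) (hs0 : s ≠ 0) (hx : q * x = x * q) : s * x = star x * s := by
  obtain ⟨a, b, rfl⟩ := Quaternion.exists_eq_add_smul_of_commute hq hx
  have hre : q.re = 0 := by
    have h0 := congrArg (·.re) hs
    have h1 := congrArg (·.imI) hs
    have h2 := congrArg (·.imJ) hs
    have h3 := congrArg (·.imK) hs
    simp only [Quaternion.re_mul, Quaternion.imI_mul, Quaternion.imJ_mul, Quaternion.imK_mul,
      Quaternion.re_neg, Quaternion.imI_neg, Quaternion.imJ_neg, Quaternion.imK_neg] at h0 h1 h2 h3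
    have : Quaternion.normSq s * q.re = 0 := by
      rw [Quaternion.normSq_def']
      linear_combination (s.re * h0 + s.imI * h1 + s.imJ * h2 + s.imK * h3) / 2
    exact (mul_eq_zero.1 this).resolve_left (Quaternion.normSq_ne_zero.2 hs0)
  have hst : star q = -q := Quaternion.star_eq_neg.2 hre
  simp [hst, mul_add, add_mul, hs, Quaternion.coe_commutes]

theorem Quaternion.eq_one_or_neg_one_of_im_eq_zero {q : ℍ[ℝ]} (hq : Quaternion.normSq q = 1)
    (h : q.im = 0) : q = 1 ∨ q = -1 := by
  have hr : q = q.re := by rw [← Quaternion.re_add_im q, h]; simp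
  rw [hr, Quaternion.normSq_coe] at hq
  rcases (sq_eq_sq_iff_eq_or_eq_neg.1 (hq.trans (one_pow 2).symm)) with h | h <;> rw [hr, h] <;> simp

theorem MonoidHom.normSq_eq_one_of_finite {P : Type*} [Group P] [Finite P] (f : P →* ℍ[ℝ])
    (x : P) : Quaternion.normSq (f x) = 1 := by
  have : Quaternion.normSq (f x) ^ Nat.card P = 1 := by
    rw [← map_pow, ← map_pow, pow_card_eq_one', map_one, map_one]
  exact (pow_eq_one_iff_of_nonneg Quaternion.normSq_nonneg Nat.card_pos.ne').1 this

/-! ### Commutators in groups with a quaternionic representation -/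

/-- If an abelian subgroup `A` and one element `s` normalizing it cover the group, every commutator
is a commutator of `s` with an element of `A`. -/
theorem exists_eq_commutatorElement_of_mem_commutator {P : Type*} [Group P] {A : Subgroup P}
    (hA : ∀ a ∈ A, ∀ b ∈ A, a * b = b * a) {s : P} (hs : ∀ a ∈ A, s * a * s⁻¹ ∈ A)
    (hs2 : s * s ∈ A) (hP : ∀ x, x ∈ A ∨ s⁻¹ * x ∈ A) {w : P} (hw : w ∈ commutator P) :
    ∃ a ∈ A, w = ⁅s, a⁆ := by
  -- `a ↦ ⁅s, a⁆` is an endomorphism of `A`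
  have hmul : ∀ a ∈ A, ∀ b ∈ A, ⁅s, a⁆ * ⁅s, b⁆ = ⁅s, a * b⁆ := by
    intro a ha b hb
    have h := hA _ (A.inv_mem ha) _ (hs b hb)
    have h2 := hA _ (A.inv_mem ha) _ (A.inv_mem hb)
    calc ⁅s, a⁆ * ⁅s, b⁆ = s * a * s⁻¹ * (a⁻¹ * (s * b * s⁻¹)) * b⁻¹ := by
          simp only [commutatorElement_def]; group
      _ = s * a * s⁻¹ * (s * b * s⁻¹) * (a⁻¹ * b⁻¹) := by rw [h]; group
      _ = ⁅s, a * b⁆ := by rw [h2]; simp only [commutatorElement_def]; group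
  let N : Subgroup P :=
    { carrier := {w | ∃ a ∈ A, w = ⁅s, a⁆}
      one_mem' := ⟨1, A.one_mem, by simp⟩
      mul_mem' := by
        rintro _ _ ⟨a, ha, rfl⟩ ⟨b, hb, rfl⟩
        exact ⟨a * b, A.mul_mem ha hb, hmul a ha b hb⟩
      inv_mem' := by
        rintro _ ⟨a, ha, rfl⟩
        refine ⟨a⁻¹, A.inv_mem ha, inv_eq_of_mul_eq_one_right ?_⟩
        rw [hmul a ha _ (A.inv_mem ha)]
        simp }
  have key : ∀ a ∈ A, ∀ b ∈ A, ⁅s * a, b⁆ ∈ N := by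
    intro a ha b hb
    refine ⟨b, hb, ?_⟩
    have := hA a ha b hb
    calc ⁅s * a, b⁆ = s * (a * b) * a⁻¹ * s⁻¹ * b⁻¹ := by simp only [commutatorElement_def]; group
      _ = ⁅s, b⁆ := by rw [this]; simp only [commutatorElement_def]; group
  have hle : commutator P ≤ N := by
    rw [commutator_def, Subgroup.commutator_le]
    intro x _ y _
    rcases hP x with hx | hx <;> rcases hP y with hy | hy
    · rw [commutatorElement_eq_one_iff_mul_comm.2 (hA x hx y hy)]
      exact N.one_mem
    · rw [← commutatorElement_inv]
      have := N.inv_mem (key _ hy x hx)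
      rwa [mul_inv_cancel_left] at this
    · have := key _ hx y hy
      rwa [mul_inv_cancel_left] at this
    · obtain ⟨a, rfl⟩ : ∃ a, x = s * a := ⟨s⁻¹ * x, by group⟩
      obtain ⟨b, rfl⟩ : ∃ b, y = s * b := ⟨s⁻¹ * y, by group⟩
      rw [inv_mul_cancel_left] at hx hy
      refine ⟨a * b⁻¹, A.mul_mem hx (A.inv_mem hy), ?_⟩
      have h1 := hA _ hs2 _ (A.mul_mem hy (A.inv_mem hx))
      have h2 := hA _ (A.mul_mem hy (A.inv_mem hx)) _ (hs _ (A.inv_mem hy))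
      calc ⁅s * a, s * b⁆ = s * a * s⁻¹ * ((s * s) * (b * a⁻¹)) * s⁻¹ * b⁻¹ * s⁻¹ := by
            simp only [commutatorElement_def]; group
        _ = s * a * s⁻¹ * ((b * a⁻¹) * (s * b⁻¹ * s⁻¹)) := by rw [h1]; group
        _ = ⁅s, a * b⁻¹⁆ := by rw [h2]; simp only [commutatorElement_def]; group
  exact hle hw

/-- Let `f` be a quaternionic representation of a `p`-group `P` in which the preimage of `{1, -1}` is
central. Then `f` is injective on the commutator subgroup. -/
theorem IsPGroup.eq_one_of_mem_commutator_of_map_eq_one {p : ℕ} [Fact p.Prime] {P : Type*}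
    [Group P] [Finite P] (hP : IsPGroup p P) (f : P →* ℍ[ℝ])
    (hc : ∀ x, f x = 1 ∨ f x = -1 → x ∈ Subgroup.center P)
    {w : P} (hw : w ∈ commutator P) (hfw : f w = 1) : w = 1 := by
  have hinv (x : P) : f x * f x⁻¹ = 1 := by rw [← map_mul, mul_inv_cancel, map_one]
  have hinv' (x : P) : f x⁻¹ * f x = 1 := by rw [← map_mul, inv_mul_cancel, map_one]
  have hne (x : P) : f x ≠ 0 := left_ne_zero_of_mul_eq_one (hinv x)
  have hstar (x : P) : star (f x) = f x⁻¹ := by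
    have h : star (f x) * f x = 1 := by
      rw [Quaternion.star_mul_self, f.normSq_eq_one_of_finite, Quaternion.coe_one]
    exact left_inv_eq_right_inv h (hinv x)
  have habel : (∀ a b : P, a * b = b * a) → w = 1 := by
    intro h
    have : commutator P ≤ ⊥ := by
      rw [commutator_def, Subgroup.commutator_le]
      intro x _ y _
      rw [commutatorElement_eq_one_iff_mul_comm.2 (h x y)]
      exact Subgroup.one_mem _
    exact Subgroup.mem_bot.1 (this hw)
  let K : Subgroup P :=
    { carrier := {x | f x = 1 ∨ f x = -1}
      one_mem' := Or.inl (map_one f)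
      mul_mem' := by
        rintro x y (hx | hx) (hy | hy) <;> simp [hx, hy]
      inv_mem' := by
        rintro x hx
        have := hinv x
        rcases hx with hx | hx
        · left; rw [hx, one_mul] at this; exact this
        · right; rw [hx] at this; rw [← neg_eq_iff_eq_neg]; simpa using this }
  have hK : K ≤ Subgroup.center P := fun x hx => hc x hx
  have hKn : K.Normal := ⟨fun x hx g => by
    rw [(Subgroup.mem_center_iff.1 (hK hx) g), mul_inv_cancel_right]; exact hx⟩
  rcases subsingleton_or_nontrivial (P ⧸ K) with hs | hs
  · have : K = ⊤ := QuotientGroup.subgroup_eq_top_of_subsingleton K hs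
    exact habel fun a b => Subgroup.mem_center_iff.1 (hK (this ▸ Subgroup.mem_top b)) a
  -- `t` is central modulo `K`, so `P` maps the rotation axis of `f t` to itself
  obtain ⟨t, htK, ht⟩ : ∃ t : P, t ∉ K ∧ ∀ x, f t * f x = f x * f t ∨ f t * f x = -(f x * f t) := by
    have := (hP.to_quotient K).center_nontrivial
    obtain ⟨⟨q, hq⟩, hq1⟩ := exists_ne (1 : Subgroup.center (P ⧸ K))
    obtain ⟨t, rfl⟩ := QuotientGroup.mk_surjective q
    refine ⟨t, fun h => hq1 (Subtype.ext ((QuotientGroup.eq_one_iff t).2 h)), fun x => ?_⟩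
    have h := Subgroup.mem_center_iff.1 hq x
    rw [← QuotientGroup.mk_mul, ← QuotientGroup.mk_mul, QuotientGroup.eq] at h
    have e : f t * f x = f (x * t) * f ((x * t)⁻¹ * (t * x)) := by
      rw [← map_mul, ← map_mul, mul_inv_cancel_left]
    rcases h with h | h <;> rw [e, h, map_mul] <;> simp
  have him : (f t).im ≠ 0 := fun h =>
    htK (Quaternion.eq_one_or_neg_one_of_im_eq_zero (f.normSq_eq_one_of_finite t) h)
  -- the elements of `P` preserving the direction of that axis
  let A : Subgroup P :=
    { carrier := {x | f t * f x = f x * f t}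
      one_mem' := by simp
      mul_mem' := by
        intro x y hx hy
        simp only [Set.mem_ofPred_eq, map_mul] at *
        rw [← mul_assoc, hx, mul_assoc, hy, mul_assoc]
      inv_mem' := by
        intro x hx
        simp only [Set.mem_ofPred_eq] at *
        calc f t * f x⁻¹ = f x⁻¹ * (f x * f t) * f x⁻¹ := by
              rw [← mul_assoc, hinv', one_mul]
          _ = f x⁻¹ * f t := by rw [← hx, mul_assoc, mul_assoc, hinv, mul_one] }
  have hAmem (x : P) : x ∈ A ↔ f t * f x = f x * f t := Iff.rfl
  have hAcomm : ∀ a ∈ A, ∀ b ∈ A, a * b = b * a := by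
    obtain ⟨φ, hφ⟩ := Quaternion.exists_algHom_complex_of_im_ne_zero him
    have hφi : Function.Injective φ := φ.toRingHom.injective
    choose z hz using fun a : A => hφ (f a) a.2
    let g : A →* ℂ :=
      { toFun := z
        map_one' := hφi (by rw [hz]; simp)
        map_mul' := fun a b => hφi (by rw [map_mul, hz, hz, hz]; simp) }
    have : Finite g.toHomUnits.range :=
      Finite.of_surjective _ g.toHomUnits.rangeRestrict_surjective
    have := isCyclic_subgroup_units g.toHomUnits.range
    have : IsMulCommutative A :=
      g.toHomUnits.rangeRestrict.isMulCommutative_of_isCyclic_of_ker_le_center (by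
        intro a ha
        have h1 : z a = 1 := by
          have := congrArg (fun u => ((u : g.toHomUnits.range) : ℂˣ)) ha
          exact congrArg Units.val this
        have h2 : f a = 1 := by rw [← hz, h1, map_one]
        rw [Subgroup.mem_center_iff]
        intro b
        exact Subtype.ext (Subgroup.mem_center_iff.1 (hc a (Or.inl h2)) b))
    intro a ha b hb
    exact congrArg Subtype.val (mul_comm' (⟨a, ha⟩ : A) ⟨b, hb⟩)
  by_cases hAt : ∀ x, x ∈ A
  · exact habel fun a b => hAcomm a (hAt a) b (hAt b)
  push Not at hAt
  obtain ⟨s, hs⟩ := hAt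
  have hanti : ∀ x ∉ A, f t * f x = -(f x * f t) := fun x hx => (ht x).resolve_left hx
  have hmulA : ∀ x ∉ A, ∀ y ∉ A, x * y ∈ A := by
    intro x hx y hy
    rw [hAmem, map_mul, ← mul_assoc, hanti x hx, neg_mul, mul_assoc, hanti y hy]
    simp [mul_assoc]
  have hsinv : s⁻¹ ∉ A := fun h => hs (by simpa using A.inv_mem h)
  have hsA : ∀ a ∈ A, s * a * s⁻¹ ∈ A := by
    intro a ha
    refine hmulA _ (fun h => hs ?_) _ hsinv
    simpa using A.mul_mem h (A.inv_mem ha)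
  obtain ⟨a, ha, rfl⟩ := exists_eq_commutatorElement_of_mem_commutator hAcomm hsA (hmulA s hs s hs)
    (fun x => or_iff_not_imp_left.2 fun hx => hmulA _ hsinv x hx) hw
  -- `s` inverts `f a`, so `f ⁅s, a⁆ = (f a)⁻²`
  have h1 : f s * f a = f a⁻¹ * f s := by
    rw [← hstar]
    exact Quaternion.mul_eq_star_mul_of_anticommute him (hanti s hs) (hne s) ha
  have h2 : f a⁻¹ * f a⁻¹ = 1 := by
    rw [commutatorElement_def, map_mul, map_mul, map_mul, h1, mul_assoc (f a⁻¹), hinv, mul_one]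
      at hfw
    exact hfw
  have h3 : f a⁻¹ = 1 ∨ f a⁻¹ = -1 := mul_self_eq_one_iff.1 h2
  have h4 : a ∈ Subgroup.center P := by simpa using Subgroup.inv_mem _ (hc _ h3)
  exact commutatorElement_eq_one_iff_mul_comm.2 (Subgroup.mem_center_iff.1 h4 s)

/-- The same for an arbitrary finite group: transfer into the abelianization of a Sylow subgroup
reduces the claim to `p`-groups. -/
theorem eq_one_of_mem_commutator_of_map_eq_one {E : Type*} [Group E] [Finite E] (f : E →* ℍ[ℝ])
    (hc : ∀ x, f x = 1 ∨ f x = -1 → x ∈ Subgroup.center E)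
    {w : E} (hw : w ∈ commutator E) (hfw : f w = 1) : w = 1 := by
  by_contra hne
  obtain ⟨p, hp, hpw⟩ := Nat.exists_prime_and_dvd (mt orderOf_eq_one_iff.1 hne)
  have : Fact p.Prime := ⟨hp⟩
  obtain ⟨v, hv, hfv, hvp⟩ : ∃ v ∈ commutator E, f v = 1 ∧ orderOf v = p :=
    ⟨w ^ (orderOf w / p), Subgroup.pow_mem _ hw _, by rw [map_pow, hfw, one_pow],
      orderOf_pow_orderOf_div (orderOf_pos w).ne' hpw⟩
  have hvc := hc v (Or.inl hfv)
  obtain ⟨P, hP⟩ := (IsPGroup.of_card (p := p) (n := 1) (G := Subgroup.zpowers v)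
    (by rw [Nat.card_zpowers, hvp, pow_one])).exists_le_sylow
  have htr := (Abelianization.of (G := P)).transfer_eq_pow v (fun k g _ => by
    rw [mul_assoc, ← Subgroup.mem_center_iff.1 (Subgroup.pow_mem _ hvc k) g, inv_mul_cancel_left])
  rw [MonoidHom.mem_ker.1 (Abelianization.commutator_subset_ker _ hv)] at htr
  have hmem := (QuotientGroup.eq_one_iff _).1 htr.symm
  have h1 := P.isPGroup'.eq_one_of_mem_commutator_of_map_eq_one (f.comp (P : Subgroup E).subtype)
    (fun x hx => Subgroup.mem_center_iff.2 fun y =>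
      Subtype.ext (Subgroup.mem_center_iff.1 (hc x hx) y)) hmem
    (by simp [hfv])
  have h2 : v ^ (P : Subgroup E).index = 1 := congrArg Subtype.val h1
  have h3 := orderOf_dvd_of_pow_eq_one h2
  rw [hvp] at h3
  exact P.not_dvd_index h3

/-! ### Extension of central characters -/

/-- The circle is an injective object for finite abelian groups. -/
theorem MonoidHom.exists_circle_extension {A B : Type*} [CommGroup A] [CommGroup B] [Finite B]
    (j : A →* B) (μ : A →* Circle) (h : j.ker ≤ μ.ker) :
    ∃ χ : B →* Circle, ∀ a, χ (j a) = μ a := by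
  let ν : j.range →* Circle := j.rangeRestrict.liftOfSurjective j.rangeRestrict_surjective
    ⟨μ, by rwa [MonoidHom.ker_rangeRestrict]⟩
  have hν (a : A) : ν (j.rangeRestrict a) = μ a :=
    MonoidHom.liftOfRightInverse_comp_apply _ _ _ _ _
  have : NeZero (Monoid.exponent B) := ⟨Monoid.exponent_ne_zero_of_finite⟩
  obtain ⟨χ, hχ⟩ := MonoidHom.domRestrict_surjective Circle j.range ν.toHomUnits
  refine ⟨(Units.coeHom Circle).comp χ, fun a => ?_⟩
  rw [← hν]
  exact congrArg Units.val (DFunLike.congr_fun hχ (j.rangeRestrict a))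

/-- The inclusion `{1, -1} → Circle`. -/
def Circle.ofIntUnits : ℤˣ →* Circle where
  toFun ε := ⟨((ε : ℤ) : ℂ), by
    rcases Int.units_eq_one_or ε with rfl | rfl <;> simp [Submonoid.unitSphere]⟩
  map_one' := by ext; simp
  map_mul' a b := by ext; simp; rfl

theorem Circle.coe_ofIntUnits (ε : ℤˣ) : (Circle.ofIntUnits ε : ℂ) = ((ε : ℤ) : ℂ) := rfl

/-- Let `f` be a quaternionic representation of a finite group `E` in which the preimage of
`{1, -1}` is central and contains a subgroup `Z × {1, -1}`. A faithful character `χ₀` of `Z` extends to `E`, either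
trivially or by the sign on the factor `{1, -1}`. -/
theorem exists_circle_character {E Z : Type*} [Group E] [Finite E] [CommGroup Z] (f : E →* ℍ[ℝ])
    (hc : ∀ x, f x = 1 ∨ f x = -1 → x ∈ Subgroup.center E)
    (j : Z × ℤˣ →* E) (hj : Function.Injective j) (hf : ∀ z ε, f (j (z, ε)) = ((ε : ℤ) : ℍ[ℝ]))
    (χ₀ : Z →* Circle) (hχ₀ : Function.Injective χ₀) :
    ∃ χ : E →* Circle, (∀ z ε, χ (j (z, ε)) = χ₀ z) ∨
      ∀ z ε, χ (j (z, ε)) = χ₀ z * Circle.ofIntUnits ε := by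
  have hone {x : Z × ℤˣ} (hx : j x ∈ commutator E) (h2 : x.2 = 1) : x.1 = 1 := by
    have h1 : x = 1 := hj <| by
      rw [map_one]
      refine eq_one_of_mem_commutator_of_map_eq_one f hc hx ?_
      rw [← Prod.mk.eta (p := x), hf, h2]
      simp
    rw [h1]; rfl
  have hext (μ : Z × ℤˣ →* Circle) (hμ : ∀ x, j x ∈ commutator E → μ x = 1) :
      ∃ χ : E →* Circle, ∀ x, χ (j x) = μ x := by
    obtain ⟨χ, hχ⟩ := (Abelianization.of.comp j).exists_circle_extension μ
      fun x hx => hμ x ((QuotientGroup.eq_one_iff _).1 hx)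
    exact ⟨χ.comp Abelianization.of, hχ⟩
  -- at most one nontrivial `j (z, ε)` is a product of commutators, and it has `ε = -1`
  by_cases H : ∃ z, j (z, -1) ∈ commutator E ∧ z ≠ 1
  · obtain ⟨z₀, hz₀, hne⟩ := H
    have hsq (z : Z) (hz : j (z, -1) ∈ commutator E) : z * z₀ = 1 :=
      hone (x := (z, -1) * (z₀, -1)) (by rw [map_mul]; exact Subgroup.mul_mem _ hz hz₀) (by simp)
    have hneg (z : Z) (hz : j (z, -1) ∈ commutator E) : (χ₀ z : ℂ) = -1 := by
      have h1 : (χ₀ z₀ : ℂ) * χ₀ z₀ = 1 := by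
        rw [← Circle.coe_mul, ← map_mul, hsq z₀ hz₀, map_one, Circle.coe_one]
      have h2 : (χ₀ z₀ : ℂ) = -1 := (mul_self_eq_one_iff.1 h1).resolve_left fun h =>
        hne (hχ₀ (by rw [map_one]; exact Circle.ext h))
      have h3 : (χ₀ z : ℂ) * χ₀ z₀ = 1 := by
        rw [← Circle.coe_mul, ← map_mul, hsq z hz, map_one, Circle.coe_one]
      rw [h2] at h3
      linear_combination -h3
    obtain ⟨χ, hχ⟩ := hext (χ₀.coprod Circle.ofIntUnits) <| by
      rintro ⟨z, ε⟩ hx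
      rcases Int.units_eq_one_or ε with rfl | rfl
      · have hz : z = 1 := hone hx rfl
        simp [hz]
      · ext
        simp [hneg z hx, Circle.coe_ofIntUnits]
    exact ⟨χ, Or.inr fun z ε => (hχ _).trans (by simp)⟩
  · push Not at H
    obtain ⟨χ, hχ⟩ := hext (χ₀.comp (MonoidHom.fst Z ℤˣ)) <| by
      rintro ⟨z, ε⟩ hx
      have hz : z = 1 := by
        rcases Int.units_eq_one_or ε with rfl | rfl
        · exact hone hx rfl
        · exact H z hx
      simp [hz]
    exact ⟨χ, Or.inl fun z ε => hχ _⟩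

/-! ### Rotations induced by quaternions -/

/-- The purely imaginary quaternion with a given vector as its imaginary part. -/
def Quaternion.ofVec (v : Fin 3 → ℝ) : ℍ[ℝ] := ⟨0, v 0, v 1, v 2⟩

/-- The quaternion `q` induces the `3 × 3` matrix `A`: `q v = (A v) q` for every purely imaginary
quaternion `v`. For a unit quaternion this says that `A` is the rotation `v ↦ q v q⁻¹`; this form
avoids the inverse. -/
def Quaternion.Induces (q : ℍ[ℝ]) (A : Matrix (Fin 3) (Fin 3) ℝ) : Prop :=
  ∀ v, q * Quaternion.ofVec v = Quaternion.ofVec (A.mulVec v) * q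

namespace Quaternion

@[simp] theorem re_ofVec (v : Fin 3 → ℝ) : (ofVec v).re = 0 := rfl
@[simp] theorem imI_ofVec (v : Fin 3 → ℝ) : (ofVec v).imI = v 0 := rfl
@[simp] theorem imJ_ofVec (v : Fin 3 → ℝ) : (ofVec v).imJ = v 1 := rfl
@[simp] theorem imK_ofVec (v : Fin 3 → ℝ) : (ofVec v).imK = v 2 := rfl

theorem ofVec_injective : Function.Injective ofVec := by
  intro v w h
  have h1 := congrArg (·.imI) h
  have h2 := congrArg (·.imJ) h
  have h3 := congrArg (·.imK) h
  ext i
  fin_cases i <;> assumption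

theorem Induces.one : Induces 1 1 := fun v => by simp

theorem Induces.mul {p q : ℍ[ℝ]} {A B : Matrix (Fin 3) (Fin 3) ℝ} (hp : Induces p A)
    (hq : Induces q B) : Induces (p * q) (A * B) := fun v => by
  rw [mul_assoc, hq v, ← mul_assoc, hp, mul_assoc, Matrix.mulVec_mulVec]

theorem Induces.of_mul_eq_one {p q : ℍ[ℝ]} {A B : Matrix (Fin 3) (Fin 3) ℝ} (hp : Induces p A)
    (hqp : q * p = 1) (hAB : A * B = 1) : Induces q B := fun v => by
  have hpq : p * q = 1 := mul_eq_one_comm.1 hqp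
  calc q * ofVec v = q * (ofVec ((A * B).mulVec v)) := by rw [hAB, Matrix.one_mulVec]
    _ = q * (ofVec (A.mulVec (B.mulVec v)) * p) * q := by
      rw [mul_assoc, mul_assoc, hpq, mul_one, Matrix.mulVec_mulVec]
    _ = ofVec (B.mulVec v) * q := by rw [← hp, ← mul_assoc, hqp, one_mul]

theorem Induces.im_eq_zero {q : ℍ[ℝ]} (hq : Induces q 1) : q.im = 0 := by
  have h1 := hq ![1, 0, 0]
  have h2 := hq ![0, 1, 0]
  simp only [Matrix.one_mulVec] at h1 h2
  have h1j := congrArg (·.imJ) h1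
  have h1k := congrArg (·.imK) h1
  have h2k := congrArg (·.imK) h2
  simp at h1j h1k h2k
  ext <;> simp <;> linarith

theorem Induces.eq_one {ε : ℤˣ} {A : Matrix (Fin 3) (Fin 3) ℝ} (h : Induces ((ε : ℤ) : ℍ[ℝ]) A) :
    A = 1 := by
  apply Matrix.mulVec_injective
  ext1 v
  apply ofVec_injective
  have := h v
  rw [Matrix.one_mulVec]
  rcases Int.units_eq_one_or ε with rfl | rfl <;> simpa using this.symm

theorem Induces.intUnits (ε : ℤˣ) : Induces ((ε : ℤ) : ℍ[ℝ]) 1 := fun v => by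
  rcases Int.units_eq_one_or ε with rfl | rfl <;> simp

/-- Averaging over the quaternion group: given two triples of quaternion units, each `y` yields an
element intertwining them. -/
theorem average_mul_eq {R : Type*} [Ring R] {i j k a b c : R} (hi : i * i = -1) (hji : j * i = -k)
    (hki : k * i = j) (ha : a * a = -1) (hab : a * b = c) (hac : a * c = -b) (y : R) :
    (y - a * y * i - b * y * j - c * y * k) * i = a * (y - a * y * i - b * y * j - c * y * k) := by
  simp only [sub_mul, mul_sub, mul_assoc, hi, hji, hki]
  simp only [← mul_assoc, ha, hab, hac]
  noncomm_ring

/-- Every rotation of space is induced by a nonzero quaternion. -/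
theorem exists_induces {A : Matrix (Fin 3) (Fin 3) ℝ}
    (hA : A ∈ Matrix.specialOrthogonalGroup (Fin 3) ℝ) : ∃ q : ℍ[ℝ], q ≠ 0 ∧ Induces q A := by
  obtain ⟨hO, hdet⟩ := Matrix.mem_specialOrthogonalGroup_iff.1 hA
  have h1 : A * A.transpose = 1 := (Matrix.mem_orthogonalGroup_iff _ _).1 hO
  have h2 : A.transpose * A = 1 := (Matrix.mem_orthogonalGroup_iff' _ _).1 hO
  have h3 : A.adjugate = A.transpose := by
    calc A.adjugate = A.adjugate * (A * A.transpose) := by rw [h1, mul_one]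
      _ = A.transpose := by rw [← mul_assoc, Matrix.adjugate_mul, hdet, one_smul, one_mul]
  have orth (r s : Fin 3) : A 0 r * A 0 s + A 1 r * A 1 s + A 2 r * A 2 s = (1 : Matrix _ _ ℝ) r s := by
    rw [← h2, Matrix.mul_apply, Fin.sum_univ_three]
    rfl
  have cross (r s : Fin 3) : A.adjugate r s = A s r := by rw [h3]; rfl
  rw [Matrix.adjugate_fin_three] at cross
  let a (r : Fin 3) : ℍ[ℝ] := ofVec fun s => A s r
  have hsq (r : Fin 3) : a r * a r = -1 := by
    have := orth r r
    rw [Matrix.one_apply_eq] at this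
    ext <;> simp [a] <;> linarith
  have h01 : a 0 * a 1 = a 2 := by
    have o := orth 0 1
    have c0 := cross 2 0
    have c1 := cross 2 1
    have c2 := cross 2 2
    simp at o c0 c1 c2
    ext <;> simp [a] <;> linarith
  have h12 : a 1 * a 2 = a 0 := by
    have o := orth 1 2
    have c0 := cross 0 0
    have c1 := cross 0 1
    have c2 := cross 0 2
    simp at o c0 c1 c2
    ext <;> simp [a] <;> linarith
  have h20 : a 2 * a 0 = a 1 := by
    have o := orth 2 0
    have c0 := cross 1 0
    have c1 := cross 1 1
    have c2 := cross 1 2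
    simp at o c0 c1 c2
    ext <;> simp [a] <;> linarith
  have h02 : a 0 * a 2 = -a 1 := by rw [← h01, ← mul_assoc, hsq, neg_one_mul]
  have h10 : a 1 * a 0 = -a 2 := by rw [← h12, ← mul_assoc, hsq, neg_one_mul]
  have h21 : a 2 * a 1 = -a 0 := by rw [← h20, ← mul_assoc, hsq, neg_one_mul]
  let i : ℍ[ℝ] := ofVec ![1, 0, 0]
  let j : ℍ[ℝ] := ofVec ![0, 1, 0]
  let k : ℍ[ℝ] := ofVec ![0, 0, 1]
  have hii : i * i = -1 := by ext <;> simp [i]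
  have hjj : j * j = -1 := by ext <;> simp [j]
  have hkk : k * k = -1 := by ext <;> simp [k]
  have hij : i * j = k := by ext <;> simp [i, j, k]
  have hjk : j * k = i := by ext <;> simp [i, j, k]
  have hki : k * i = j := by ext <;> simp [i, j, k]
  have hji : j * i = -k := by ext <;> simp [i, j, k]
  have hkj : k * j = -i := by ext <;> simp [i, j, k]
  have hik : i * k = -j := by ext <;> simp [i, j, k]
  let T (y : ℍ[ℝ]) : ℍ[ℝ] := y - a 0 * y * i - a 1 * y * j - a 2 * y * k
  have hTi (y) : T y * i = a 0 * T y := average_mul_eq hii hji hki (hsq 0) h01 h02 y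
  have hTj (y) : T y * j = a 1 * T y := by
    have := average_mul_eq hjj hkj hij (hsq 1) h12 h10 y
    have e : T y = y - a 1 * y * j - a 2 * y * k - a 0 * y * i := by simp only [T]; abel
    rw [e, this]
  have hTk (y) : T y * k = a 2 * T y := by
    have := average_mul_eq hkk hik hjk (hsq 2) h20 h21 y
    have e : T y = y - a 2 * y * k - a 0 * y * i - a 1 * y * j := by simp only [T]; abel
    rw [e, this]
  have hT (y) : Induces (T y) A := by
    intro v
    have e1 : ofVec v = v 0 • i + v 1 • j + v 2 • k := by
      ext <;> simp [i, j, k]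
    have e2 : ofVec (A.mulVec v) = v 0 • a 0 + v 1 • a 1 + v 2 • a 2 := by
      ext <;> simp [a, Matrix.mulVec, dotProduct, Fin.sum_univ_three] <;> ring
    rw [e1, e2]
    simp only [mul_add, add_mul, mul_smul_comm, smul_mul_assoc, hTi, hTj, hTk]
  -- the trace `T 1 + T i i⁻¹ + T j j⁻¹ + T k k⁻¹` is `4`, so some `T y` is nonzero
  have hsum : T 1 - T i * i - T j * j - T k * k = ((4 : ℝ) : ℍ[ℝ]) := by
    simp only [T, sub_mul, mul_assoc, hii, hjj, hkk, hij, hjk, hki, hji, hkj, hik, mul_neg, mul_one,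
      neg_mul, one_mul]
    have : ((4 : ℝ) : ℍ[ℝ]) = 1 + 1 + 1 + 1 := by
      norm_cast
    rw [this]
    abel
  by_contra! H
  have hz (y) : T y = 0 := by
    by_contra h
    exact H _ h (hT y)
  simp only [hz, zero_mul, sub_zero] at hsum
  have := congrArg (·.re) hsum
  rw [re_coe] at this
  exact four_ne_zero this.symm

end Quaternion

/-! ### Orthogonal matrices -/

namespace Quaternion

/-- Every rotation of space is induced by a unit quaternion. -/
theorem exists_unitary_induces {A : Matrix (Fin 3) (Fin 3) ℝ}
    (hA : A ∈ Matrix.specialOrthogonalGroup (Fin 3) ℝ) : ∃ q : unitary ℍ[ℝ], Induces q A := by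
  obtain ⟨q, hq, hqA⟩ := exists_induces hA
  have hn := norm_ne_zero_iff.2 hq
  have h1 : normSq (‖q‖⁻¹ • q) = 1 := by
    rw [normSq_smul, normSq_eq_norm_mul_self]
    field_simp
  refine ⟨⟨‖q‖⁻¹ • q, Unitary.mem_iff.2 ⟨?_, ?_⟩⟩, fun v => ?_⟩
  · rw [star_mul_self, h1, coe_one]
  · rw [self_mul_star, h1, coe_one]
  · change ‖q‖⁻¹ • q * ofVec v = ofVec (A.mulVec v) * ‖q‖⁻¹ • q
    rw [smul_mul_assoc, hqA, mul_smul_comm]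

/-- The matrix of left multiplication by `q` in the basis `1, i, j, k`. -/
def leftMatrix : ℍ[ℝ] →* Matrix (Fin 4) (Fin 4) ℝ where
  toFun q := !![q.re, -q.imI, -q.imJ, -q.imK; q.imI, q.re, -q.imK, q.imJ;
    q.imJ, q.imK, q.re, -q.imI; q.imK, -q.imJ, q.imI, q.re]
  map_one' := by
    ext r s
    fin_cases r <;> fin_cases s <;> simp
  map_mul' p q := by
    ext r s
    fin_cases r <;> fin_cases s <;> simp [Matrix.mul_apply, Fin.sum_univ_four] <;> ring

/-- The matrix of right multiplication by the complex number `z` on the quaternions, in the basis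
`1, i, j, k`. -/
def rightMatrix : ℂ →* Matrix (Fin 4) (Fin 4) ℝ where
  toFun z := !![z.re, -z.im, 0, 0; z.im, z.re, 0, 0; 0, 0, z.re, z.im; 0, 0, -z.im, z.re]
  map_one' := by
    ext r s
    fin_cases r <;> fin_cases s <;> simp
  map_mul' p q := by
    ext r s
    fin_cases r <;> fin_cases s <;> simp [Matrix.mul_apply, Fin.sum_univ_four] <;> ring

theorem leftMatrix_apply (q : ℍ[ℝ]) : leftMatrix q =
    !![q.re, -q.imI, -q.imJ, -q.imK; q.imI, q.re, -q.imK, q.imJ;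
      q.imJ, q.imK, q.re, -q.imI; q.imK, -q.imJ, q.imI, q.re] := rfl

theorem rightMatrix_apply (z : ℂ) : rightMatrix z =
    !![z.re, -z.im, 0, 0; z.im, z.re, 0, 0; 0, 0, z.re, z.im; 0, 0, -z.im, z.re] := rfl

theorem leftMatrix_mul_rightMatrix (q : ℍ[ℝ]) (z : ℂ) :
    leftMatrix q * rightMatrix z = rightMatrix z * leftMatrix q := by
  rw [leftMatrix_apply, rightMatrix_apply]
  ext r s
  fin_cases r <;> fin_cases s <;> simp [Matrix.mul_apply, Fin.sum_univ_four] <;> ring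

theorem transpose_leftMatrix (q : ℍ[ℝ]) : (leftMatrix q).transpose = leftMatrix (star q) := by
  rw [leftMatrix_apply, leftMatrix_apply]
  ext r s
  fin_cases r <;> fin_cases s <;> simp

theorem transpose_rightMatrix (z : ℂ) : (rightMatrix z).transpose = rightMatrix (star z) := by
  rw [rightMatrix_apply, rightMatrix_apply]
  ext r s
  fin_cases r <;> fin_cases s <;> simp

theorem leftMatrix_mul_rightMatrix_mem {q : ℍ[ℝ]} (hq : q * star q = 1) (z : Circle) :
    leftMatrix q * rightMatrix z ∈ Matrix.orthogonalGroup (Fin 4) ℝ := by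
  have hz : (z : ℂ) * star (z : ℂ) = 1 := by
    rw [Complex.star_def, Complex.mul_conj, Circle.normSq_coe, Complex.ofReal_one]
  rw [Matrix.mem_orthogonalGroup_iff, Matrix.transpose_mul, transpose_leftMatrix,
    transpose_rightMatrix, mul_assoc, ← mul_assoc (rightMatrix _), ← map_mul, hz, map_one, one_mul,
    ← map_mul, hq, map_one]

/-- If the map `x ↦ q x z` of the quaternions is the identity, then `q` is real. -/
theorem im_eq_zero_of_leftMatrix_mul_rightMatrix_eq_one {q : ℍ[ℝ]} {z : ℂ}
    (h : leftMatrix q * rightMatrix z = 1) : q.im = 0 := by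
  have e (r s : Fin 4) := congrFun (congrFun h r) s
  have e00 := e 0 0
  have e10 := e 1 0
  have e20 := e 2 0
  have e30 := e 3 0
  have e22 := e 2 2
  have e32 := e 3 2
  simp [leftMatrix_apply, rightMatrix_apply, Matrix.mul_apply, Fin.sum_univ_four]
    at e00 e10 e20 e30 e22 e32
  have hre : q.re * z.re = 1 := by linarith
  have hI : q.imI * z.re = 0 := by linarith
  have hb : q.re * z.im = 0 := by linarith
  have hz : z.re ≠ 0 := right_ne_zero_of_mul_eq_one hre
  have hb' : z.im = 0 := (mul_eq_zero.1 hb).resolve_left (left_ne_zero_of_mul_eq_one hre)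
  simp only [hb', mul_zero, neg_zero, add_zero] at e20 e30
  ext
  · simp
  · simpa [hz] using hI
  · simpa [hz] using e20
  · simpa [hz] using e30

end Quaternion

/-- The rotation of the plane given by multiplication by a point of the circle. -/
def Circle.rotationMatrix : Circle →* Matrix (Fin 2) (Fin 2) ℝ where
  toFun z := !![(z : ℂ).re, -(z : ℂ).im; (z : ℂ).im, (z : ℂ).re]
  map_one' := by
    ext r s
    fin_cases r <;> fin_cases s <;> simp
  map_mul' p q := by
    ext r s
    fin_cases r <;> fin_cases s <;> simp [Matrix.mul_apply, Fin.sum_univ_two] <;> ring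

theorem Circle.rotationMatrix_mem (z : Circle) :
    Circle.rotationMatrix z ∈ Matrix.specialOrthogonalGroup (Fin 2) ℝ := by
  have h : (z : ℂ).re * (z : ℂ).re + (z : ℂ).im * (z : ℂ).im = 1 := by
    rw [← Complex.normSq_apply, Circle.normSq_coe]
  rw [Matrix.mem_specialOrthogonalGroup_iff, Matrix.mem_orthogonalGroup_iff]
  constructor
  · ext r s
    fin_cases r <;> fin_cases s <;>
      simp [Circle.rotationMatrix, Matrix.mul_apply, Fin.sum_univ_two] <;> linarith
  · simp [Circle.rotationMatrix, Matrix.det_fin_two]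
    linarith

theorem Circle.eq_one_of_rotationMatrix_eq_one {z : Circle} (h : Circle.rotationMatrix z = 1) :
    z = 1 := by
  have h0 := congrFun (congrFun h 0) 0
  have h1 := congrFun (congrFun h 1) 0
  simp [Circle.rotationMatrix] at h0 h1
  exact Circle.ext (Complex.ext h0 h1)

/-- Two orthogonal representations with equal determinants and total dimension `d` assemble
to a representation in `SO(d)`, whose kernel is the intersection of the two kernels. -/
theorem exists_hom_specialOrthogonalGroup {E : Type*} [Group E] {m n d : ℕ} (hd : m + n = d)
    (A : E →* Matrix (Fin m) (Fin m) ℝ) (B : E →* Matrix (Fin n) (Fin n) ℝ)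
    (hA : ∀ e, A e ∈ Matrix.orthogonalGroup (Fin m) ℝ)
    (hB : ∀ e, B e ∈ Matrix.orthogonalGroup (Fin n) ℝ)
    (hdet : ∀ e, (A e).det * (B e).det = 1) :
    ∃ Ψ : E →* Matrix.specialOrthogonalGroup (Fin d) ℝ, ∀ e, Ψ e = 1 ↔ A e = 1 ∧ B e = 1 := by
  subst hd
  let Φ : E →* Matrix (Fin m ⊕ Fin n) (Fin m ⊕ Fin n) ℝ :=
    { toFun := fun e => Matrix.fromBlocks (A e) 0 0 (B e)
      map_one' := by simp
      map_mul' := fun x y => by simp [Matrix.fromBlocks_multiply] }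
  let r := Matrix.reindexAlgEquiv ℝ ℝ (finSumFinEquiv (m := m) (n := n))
  let ρ := (MonoidHomClass.toMonoidHom r).comp Φ
  have hmem (e : E) : ρ e ∈ Matrix.specialOrthogonalGroup (Fin (m + n)) ℝ := by
    rw [Matrix.mem_specialOrthogonalGroup_iff, Matrix.mem_orthogonalGroup_iff]
    have h1 := (Matrix.mem_orthogonalGroup_iff _ _).1 (hA e)
    have h2 := (Matrix.mem_orthogonalGroup_iff _ _).1 (hB e)
    change r (Φ e) * (r (Φ e)).transpose = 1 ∧ (r (Φ e)).det = 1
    constructor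
    · have : (r (Φ e)).transpose = r (Φ e).transpose := rfl
      rw [this, ← map_mul]
      simp [Φ, Matrix.fromBlocks_transpose, Matrix.fromBlocks_multiply, h1, h2]
    · rw [Matrix.det_reindexAlgEquiv]
      exact (Matrix.det_fromBlocks_zero₂₁ _ _ _).trans (hdet e)
  refine ⟨ρ.codRestrict _ hmem, fun e => ?_⟩
  have h1 : ρ.codRestrict _ hmem e = 1 ↔ r (Φ e) = 1 := Subtype.ext_iff
  rw [h1, map_eq_one_iff r r.injective]
  change Matrix.fromBlocks (A e) 0 0 (B e) = 1 ↔ _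
  rw [← Matrix.fromBlocks_one, Matrix.fromBlocks_inj]
  simp

/-! ### The pullback of the spin cover -/

/-- The inclusion of `{1, -1}` into the unit quaternions. -/
def Quaternion.ofIntUnits : ℤˣ →* unitary ℍ[ℝ] where
  toFun ε := ⟨((ε : ℤ) : ℍ[ℝ]), by
    rcases Int.units_eq_one_or ε with rfl | rfl <;> simp [Unitary.mem_iff]⟩
  map_one' := by ext1; simp
  map_mul' a b := by ext1; simp

theorem Quaternion.leftMatrix_mul_rightMatrix_intUnits (ε : ℤˣ) :
    Quaternion.leftMatrix ((ε : ℤ) : ℍ[ℝ]) * Quaternion.rightMatrix ((ε : ℤ) : ℂ) = 1 := by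
  rw [Quaternion.leftMatrix_apply, Quaternion.rightMatrix_apply]
  ext r s
  rcases Int.units_eq_one_or ε with rfl | rfl <;> fin_cases r <;> fin_cases s <;>
    simp [Matrix.mul_apply, Fin.sum_univ_four]

theorem Quaternion.normSq_coe_unitary (q : unitary ℍ[ℝ]) :
    Quaternion.normSq (q : ℍ[ℝ]) = 1 := by
  have h := Unitary.mul_star_self_of_mem q.2
  rw [Quaternion.self_mul_star] at h
  exact Quaternion.coe_injective (h.trans Quaternion.coe_one.symm)

/-- The pullback of the double cover of `SO(3)` by the unit quaternions along `α : G → SO(3)`: the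
group of pairs `(g, q)` such that `q` induces the rotation `α g`. -/
def Quaternion.spinPullback {G : Type*} [Group G] (α : G →* Matrix (Fin 3) (Fin 3) ℝ) :
    Subgroup (G × unitary ℍ[ℝ]) where
  carrier := {x | Quaternion.Induces x.2 (α x.1)}
  one_mem' := by simpa using! Quaternion.Induces.one
  mul_mem' := by
    intro x y hx hy
    simpa using! Quaternion.Induces.mul hx hy
  inv_mem' := by
    intro x hx
    refine Quaternion.Induces.of_mul_eq_one hx ?_ ?_
    · rw [← Submonoid.coe_mul]
      simp
    · rw [← map_mul]
      simp

/-- If `Ψ : E → M` and a surjection `E → G` have the same kernel, then `G` is isomorphic to the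
image of `Ψ`. -/
theorem MonoidHom.nonempty_mulEquiv_range_of_surjective {E G M : Type*} [Group E] [Group G]
    [Group M] (π : E →* G) (hπ : Function.Surjective π) (Ψ : E →* M)
    (h : ∀ e, Ψ e = 1 ↔ π e = 1) : Nonempty (G ≃* Ψ.range) := by
  have hk : π.ker = Ψ.ker := by
    ext e
    exact (h e).symm
  exact ⟨(QuotientGroup.quotientKerEquivOfSurjective π hπ).symm.trans
    ((QuotientGroup.quotientMulEquivOfEq hk).trans (QuotientGroup.quotientKerEquivRange Ψ))⟩

theorem theorem7p1 {G : Type*} [Group G] [Finite G] (k : ℕ)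
    (H : Subgroup (Matrix.specialOrthogonalGroup (Fin 3) ℝ)) [Finite H]
    (S : GroupExtension (Multiplicative (ZMod k)) G H) (hS : S.IsCentralExt) :
    ∃ K : Subgroup (Matrix.specialOrthogonalGroup (Fin 5) ℝ), Nonempty (G ≃* K) := by
  have : NeZero k := by
    refine ⟨?_⟩
    rintro rfl
    -- `ZMod 0 = ℤ` does not embed in a finite group
    have hinf : Infinite (Multiplicative ℤ) := inferInstance
    exact hinf.not_finite (Finite.of_injective _ S.inl_injective)
  let α : G →* Matrix (Fin 3) (Fin 3) ℝ :=
    (Matrix.specialOrthogonalGroup (Fin 3) ℝ).subtype.comp (H.subtype.comp S.rightHom)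
  have hα (g : G) : α g ∈ Matrix.specialOrthogonalGroup (Fin 3) ℝ := (S.rightHom g : _).1.2
  have hα1 (g : G) (hg : α g = 1) : ∃ z, S.inl z = g := by
    have h1 : S.rightHom g = 1 := Subtype.ext (Subtype.ext hg)
    rwa [← MonoidHom.mem_ker, ← S.range_inl_eq_ker_rightHom] at h1
  have hαinl (z) : α (S.inl z) = 1 := by simp [α]
  let E := Quaternion.spinPullback α
  let π : E →* G := (MonoidHom.fst G (unitary ℍ[ℝ])).comp E.subtype
  let f : E →* ℍ[ℝ] := (unitary ℍ[ℝ]).subtype.comp ((MonoidHom.snd G (unitary ℍ[ℝ])).comp E.subtype)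
  have hE (x : E) : Quaternion.Induces (f x) (α (π x)) := x.2
  have hπ : Function.Surjective π := fun g => by
    obtain ⟨q, hq⟩ := Quaternion.exists_unitary_induces (hα g)
    exact ⟨⟨(g, q), hq⟩, rfl⟩
  let j : Multiplicative (ZMod k) × ℤˣ →* E := (S.inl.prodMap Quaternion.ofIntUnits).codRestrict E
    fun x => by
      change Quaternion.Induces ((x.2 : ℤ) : ℍ[ℝ]) (α (S.inl x.1))
      rw [hαinl]
      exact Quaternion.Induces.intUnits _
  have hπj (z ε) : π (j (z, ε)) = S.inl z := rfl
  have hfj (z ε) : f (j (z, ε)) = ((ε : ℤ) : ℍ[ℝ]) := rfl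
  have hext (x y : E) (h1 : π x = π y) (h2 : f x = f y) : x = y :=
    Subtype.ext (Prod.ext h1 (Subtype.ext h2))
  have hj : Function.Injective j := by
    rintro ⟨z, ε⟩ ⟨z', ε'⟩ h
    have h1 : S.inl z = S.inl z' := congrArg π h
    have h2 : ((ε : ℤ) : ℍ[ℝ]) = ((ε' : ℤ) : ℍ[ℝ]) := congrArg f h
    have h3 : (ε : ℤ) = ε' := by
      have := congrArg (·.re) h2
      simpa using this
    rw [S.inl_injective h1, Units.ext h3]
  have hjf (x : E) (hx : (f x).im = 0) : ∃ z ε, j (z, ε) = x := by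
    obtain ⟨ε, hε⟩ : ∃ ε : ℤˣ, f x = ((ε : ℤ) : ℍ[ℝ]) := by
      rcases Quaternion.eq_one_or_neg_one_of_im_eq_zero (Quaternion.normSq_coe_unitary _) hx with
        h | h
      · exact ⟨1, h.trans (by simp)⟩
      · exact ⟨-1, h.trans (by simp)⟩
    have h1 := hE x
    rw [hε] at h1
    obtain ⟨z, hz⟩ := hα1 _ h1.eq_one
    exact ⟨z, ε, hext _ _ hz hε.symm⟩
  have hjα (x : E) (hx : α (π x) = 1) : ∃ z ε, j (z, ε) = x :=
    hjf x (by have := hE x; rw [hx] at this; exact this.im_eq_zero)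
  have hc (x : E) (hx : f x = 1 ∨ f x = -1) : x ∈ Subgroup.center E := by
    obtain ⟨z, ε, rfl⟩ := hjf x (by rcases hx with h | h <;> rw [h] <;> ext <;> simp)
    rw [Subgroup.mem_center_iff]
    intro y
    refine hext _ _ ?_ ?_
    · rw [map_mul, map_mul]
      exact Subgroup.mem_center_iff.1 (hS ⟨z, rfl⟩) _
    · rw [map_mul, map_mul]
      rcases hx with h | h <;> rw [h] <;> simp
  have : Finite E := by
    have : Finite π.ker := by
      have hmem (x : π.ker) : (x : E) ∈ j.range := by
        obtain ⟨z, ε, h⟩ := hjα x (by rw [MonoidHom.mem_ker.1 x.2, map_one])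
        exact ⟨_, h⟩
      have : Finite j.range := Finite.of_surjective _ j.rangeRestrict_surjective
      exact Finite.of_injective (fun x : π.ker => (⟨x, hmem x⟩ : j.range)) fun x y h =>
        Subtype.ext (congrArg (fun u : j.range => (u : E)) h)
    exact π.finite_iff_finite_ker_range.2 ⟨this, inferInstance⟩
  let χ₀ : Multiplicative (ZMod k) →* Circle := (ZMod.toCircle (N := k)).toMonoidHom
  have hχ₀ : Function.Injective χ₀ := ZMod.injective_toCircle
  obtain ⟨χ, hχ | hχ⟩ := exists_circle_character f hc j hj hfj χ₀ hχ₀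
  -- if `χ` kills the kernel of `E → G`, add `χ : G → SO(2)` to the action of `G` by rotations of `ℝ³`
  · obtain ⟨Ψ, hΨ⟩ := exists_hom_specialOrthogonalGroup (d := 5) rfl
      (Circle.rotationMatrix.comp χ) (α.comp π)
      (fun e => (Circle.rotationMatrix_mem _).1) (fun e => (hα _).1)
      (fun e => by
        rw [MonoidHom.comp_apply, MonoidHom.comp_apply,
          (Matrix.mem_specialOrthogonalGroup_iff.1 (Circle.rotationMatrix_mem _)).2,
          (Matrix.mem_specialOrthogonalGroup_iff.1 (hα _)).2, one_mul])
    refine ⟨Ψ.range, π.nonempty_mulEquiv_range_of_surjective hπ Ψ fun e => ?_⟩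
    rw [hΨ, MonoidHom.comp_apply, MonoidHom.comp_apply]
    constructor
    · rintro ⟨h1, h2⟩
      obtain ⟨z, ε, rfl⟩ := hjα e h2
      have h3 := Circle.eq_one_of_rotationMatrix_eq_one h1
      rw [hχ, map_eq_one_iff χ₀ hχ₀] at h3
      rw [hπj, h3, map_one]
    · intro h
      have h2 : α (π e) = 1 := by rw [h, map_one]
      refine ⟨?_, h2⟩
      obtain ⟨z, ε, rfl⟩ := hjα e h2
      rw [hπj, map_eq_one_iff _ S.inl_injective] at h
      rw [hχ, h, map_one, map_one]
  -- if `χ` is the sign on the kernel of `E → G`, the isometry `x ↦ q x χ(g, q)` of `ℍ` depends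
  -- only on `g`; its determinant is added as a fifth dimension to land in `SO(5)`
  · let A : E →* Matrix (Fin 4) (Fin 4) ℝ :=
      { toFun := fun e => Quaternion.leftMatrix (f e) * Quaternion.rightMatrix (χ e)
        map_one' := by simp
        map_mul' := fun x y => by
          rw [map_mul, map_mul, map_mul, Circle.coe_mul, map_mul, mul_assoc, mul_assoc,
            ← mul_assoc (Quaternion.leftMatrix (f y)), Quaternion.leftMatrix_mul_rightMatrix (f y),
            mul_assoc] }
    have hA (e) : A e ∈ Matrix.orthogonalGroup (Fin 4) ℝ :=
      Quaternion.leftMatrix_mul_rightMatrix_mem (Unitary.mul_star_self_of_mem e.1.2.2) _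
    have hdet (e) : (A e).det * (A e).det = 1 := by
      have := congrArg Matrix.det ((Matrix.mem_orthogonalGroup_iff _ _).1 (hA e))
      rwa [Matrix.det_mul, Matrix.det_transpose, Matrix.det_one] at this
    let B : E →* Matrix (Fin 1) (Fin 1) ℝ :=
      ((Matrix.scalar (Fin 1) : ℝ →+* _) : ℝ →* _).comp (Matrix.detMonoidHom.comp A)
    have hB (e) : B e = Matrix.scalar (Fin 1) (A e).det := rfl
    obtain ⟨Ψ, hΨ⟩ := exists_hom_specialOrthogonalGroup (d := 5) rfl A B hA
      (fun e => by
        rw [Matrix.mem_orthogonalGroup_iff, hB, Matrix.scalar_apply, Matrix.diagonal_transpose,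
          Matrix.diagonal_mul_diagonal, hdet, Matrix.diagonal_one])
      (fun e => by rw [hB, Matrix.scalar_apply, Matrix.det_diagonal]; simpa using hdet e)
    refine ⟨Ψ.range, π.nonempty_mulEquiv_range_of_surjective hπ Ψ fun e => ?_⟩
    have hBA : A e = 1 → B e = 1 := fun h => by rw [hB, h, Matrix.det_one, map_one]
    rw [hΨ, and_iff_left_of_imp hBA]
    have hAj (z ε) : A (j (z, ε)) = Quaternion.rightMatrix (χ₀ z) := by
      change Quaternion.leftMatrix (f (j (z, ε))) * Quaternion.rightMatrix (χ (j (z, ε))) = _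
      rw [hχ, hfj, Circle.coe_mul, Circle.coe_ofIntUnits, mul_comm (χ₀ z : ℂ), map_mul, ← mul_assoc,
        Quaternion.leftMatrix_mul_rightMatrix_intUnits, one_mul]
    constructor
    · intro h
      obtain ⟨z, ε, rfl⟩ := hjf e (Quaternion.im_eq_zero_of_leftMatrix_mul_rightMatrix_eq_one h)
      rw [hAj] at h
      have h0 := congrFun (congrFun h 0) 0
      have h1 := congrFun (congrFun h 1) 0
      simp [Quaternion.rightMatrix_apply] at h0 h1
      have h2 : χ₀ z = 1 := Circle.ext (Complex.ext h0 h1)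
      rw [map_eq_one_iff χ₀ hχ₀] at h2
      rw [hπj, h2, map_one]
    · intro h
      obtain ⟨z, ε, rfl⟩ := hjα e (by rw [h, map_one])
      rw [hπj, map_eq_one_iff _ S.inl_injective] at h
      rw [hAj, h, map_one, Circle.coe_one, map_one]
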